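/- Consider the following $T$-stage game between a principal $A$ and a receiver $B$, with finite non-empty sets $\mathcal X_t$ of states, and finite sets $\mathcal U_t$ of actions and $\mathcal M_t$ of outcomes. The initial state $X_1$ has distribution $\hat\pi\in\Delta(\mathcal X_1)$, and neither player observes the states. At stage $t=1,\dots,T$ the principal publicly chooses an experiment $\sigma_t:\mathcal X_t\to\Delta(\mathcal M_t)$ (the set of experiments is $\mathcal S_t$); its outcome $M_t\sim\sigma_t(\cdot\mid X_t)$ is observed by both players; the receiver publicly chooses an action $U_t\in\mathcal U_t$; each player $i\in\{A,B\}$ gets $r^i_t(X_t,U_t)$. If $U_t$ lies in a given set $\overline{\mathcal U}_t\subset\mathcal U_t$ of terminating actions, the game ends; otherwise $X_{t+1}\sim P_t(\cdot\mid X_t,U_t)$ and stage $t+1$ follows if $t<T$. Each player maximizes the expected sum of his rewards. Pure strategies choose $\sigma_t$ as a function of the principal's information $h_t^A=(\sigma_s,m_s,u_s)_{s<t}$, and $U_t$ as a function of the receiver's information $h_t^B=(h_t^A,\sigma_t,m_t)$, for histories without a terminating action. A belief system assigns to every $h_t^A$ and every $h_t^B$ a distribution of $(X_1,\dots,X_t)$.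 A perfect Bayesian equilibrium (PBE) is a pair of a strategy profile and a belief system such that, at every history of either player, no change of his own strategy raises his expected reward-to-go under his belief there, and such that beliefs start at $\hat\pi$ and are updated by Bayes' law (after each experiment and outcome, and after each non-terminating action, including after deviations) whenever the denominator is non-zero. For $\pi\in\Delta(\mathcal X_t)$ let $\xi_t(\pi,\sigma,m)(x)=\pi(x)\sigma(m|x)/\sum_y\pi(y)\sigma(m|y)$ (the uniform distribution if the denominator is $0$) and $\ell_t(\pi,u)(x')=\sum_x\pi(x)P_t(x'|x,u)$. The canonical beliefs are given by $\kappa^A_1=\hat\pi$, $\kappa^B_t(h_t^B)=\xi_t(\kappa^A_t(h_t^A),\sigma_t,m_t)$, $\kappa^A_{t+1}(h_{t+1}^A)=\ell_t(\kappa^B_t(h_t^B),u_t)$. A canonical belief based (CBB) strategy profile is a family of maps $\lambda^A_t:\Delta(\mathcal X_t)\to\mathcal S_t$ and $\lambda^B_t:\Delta(\mathcal X_t)\to\mathcal U_t$, standing for the strategies $h^i_t\mapsto\lambda^i_t(\kappa^i_t(h^i_t))$. For a triangulation $\gamma$ of $\Delta(\mathcal X_t)$ and $\pi\in\Delta(\mathcal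 X_t)$ let $\mathbb C(\pi,\gamma)$ be the unique representation of $\pi$ as a convex combination of the vertices of a simplex of $\gamma$, seen as a finitely supported probability measure; for $f:\Delta(\mathcal X_t)\to\mathbb R$ let $\mathbb I(f,\gamma)(\pi)=\int f\,d\mathbb C(\pi,\gamma)$, let $\mathrm{cav}(f)(\pi)=\sup\{z:(\pi,z)\in\mathrm{conv}(\mathrm{graph} f)\}$, and let $\arg\mathrm{cav}(f)$ be the set of triangulations $\gamma$ with $\mathbb I(f,\gamma)=\mathrm{cav}(f)$. An experiment $\sigma$ induces $\eta$ from $\pi$ if $\eta(\rho)=\sum_m\mathbf 1_{\{\rho=\xi_t(\pi,\sigma,m)\}}\sum_x\sigma(m|x)\pi(x)$ for all $\rho\in\Delta(\mathcal X_t)$. Let $V^A_{T+1}=V^B_{T+1}=0$ and, for $t=T,\dots,1$, $\pi\in\Delta(\mathcal X_t)$, $u\in\mathcal U_t$ and $i\in\{A,B\}$, $$\hat q^i_t(\pi,u)=\sum_x r^i_t(x,u)\pi(x)+\begin{cases}V^i_{t+1}(\ell_t(\pi,u)) & u\notin\overline{\mathcal U}_t\\ 0 & u\in\overline{\mathcal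 U}_t,\end{cases}$$ $$\Upsilon_t(\pi)=\arg\max_u\hat q^B_t(\pi,u),\quad \hat v^A_t(\pi)=\max_{u\in\Upsilon_t(\pi)}\hat q^A_t(\pi,u),\quad \hat v^B_t(\pi)=\max_u\hat q^B_t(\pi,u),$$ $$\gamma_t\in\arg\mathrm{cav}(\hat v^A_t),\qquad V^i_t=\mathbb I(\hat v^i_t,\gamma_t).$$ Let $\lambda^{*B}_t(\pi)$ be any action attaining the maximum that defines $\hat v^A_t(\pi)$, and $\lambda^{*A}_t(\pi)$ any experiment that induces $\mathbb C(\pi,\gamma_t)$ from $\pi$. Then, for every such choice of $\gamma$, $\lambda^{*A}$ and $\lambda^{*B}$, the CBB strategies $(\lambda^{*A},\lambda^{*B})$ form, together with some belief system, a PBE, and $V^A_1(\hat\pi)$ and $V^B_1(\hat\pi)$ are the expected total payoffs of the principal and the receiver in this equilibrium. -/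

import Mathlib

noncomputable section

namespace SignalPicking

/-! ### Discrete geometry: triangulations, interpolation, concave closure -/

section Geometry

variable {E : Type*} [AddCommGroup E] [Module ℝ E]

/-- A triangulation of `Ω`: a finite simplicial complex whose simplices cover exactly `Ω`. -/
structure Triangulation (Ω : Set E) extends Geometry.SimplicialComplex ℝ E where
  finite_faces : faces.Finite
  space_eq : toSimplicialComplex.space = Ω

variable {Ω : Set E}

/-- `c` is a representation of `ω` as a convex combination of the vertices of one simplex
of `γ`; it is recorded as a finitely supported measure on `Ω`. -/
structure IsBarycentric (γ : Triangulation Ω) (ω : Ω) (c : Ω →₀ ℝ) : Prop where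
  face : ∃ s ∈ γ.faces, ∀ v ∈ c.support, (v : E) ∈ s
  nonneg : ∀ v, 0 ≤ c v
  total : (c.sum fun _ a => a) = 1
  center : (c.sum fun v a => a • (v : E)) = ω

theorem exists_isBarycentric (γ : Triangulation Ω) (ω : Ω) :
    ∃ c : Ω →₀ ℝ, IsBarycentric γ ω c := by
  classical
  have hω : (ω : E) ∈ γ.toSimplicialComplex.space := by rw [γ.space_eq]; exact ω.2
  obtain ⟨s, hs, hmem⟩ := Geometry.SimplicialComplex.mem_space_iff.1 hω
  have hsub : ∀ v ∈ s, v ∈ Ω := fun v hv => by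
    have := Geometry.SimplicialComplex.subset_space hs (Finset.mem_coe.2 hv)
    rwa [γ.space_eq] at this
  obtain ⟨w, hw0, hw1, hwc⟩ := Finset.mem_convexHull'.1 hmem
  refine ⟨∑ v ∈ s.attach, Finsupp.single ⟨v.1, hsub v.1 v.2⟩ (w v.1), ⟨s, hs, ?_⟩, ?_, ?_, ?_⟩
  · intro v hv
    obtain ⟨i, -, hi⟩ := Finset.mem_biUnion.1 (Finsupp.support_finsetSum hv)
    have := Finsupp.support_single_subset hi
    rw [Finset.mem_singleton] at this
    rw [this]; exact i.2
  · intro v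
    rw [Finsupp.finsetSum_apply]
    refine Finset.sum_nonneg fun i _ => ?_
    rw [Finsupp.single_apply]
    split_ifs
    · exact hw0 _ i.2
    · exact le_rfl
  · rw [← Finsupp.sum_finsetSum_index (fun _ => rfl) (fun _ _ _ => rfl)]
    simp only [Finsupp.sum_single_index]
    rw [Finset.sum_attach s w, hw1]
  · rw [← Finsupp.sum_finsetSum_index (h := fun (v : Ω) (a : ℝ) => a • (v : E))
      (fun _ => zero_smul _ _) (fun _ _ _ => add_smul _ _ _)]
    simp only [zero_smul, Finsupp.sum_single_index]
    rw [Finset.sum_attach s (fun v => w v • v), hwc]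

theorem IsBarycentric.unique {γ : Triangulation Ω} {ω : Ω} {c d : Ω →₀ ℝ}
    (hc : IsBarycentric γ ω c) (hd : IsBarycentric γ ω d) : c = d := by
  classical
  have key : ∀ {c : Ω →₀ ℝ}, IsBarycentric γ ω c → ∀ {s : Finset E}, s ∈ γ.faces →
      (∀ v ∈ c.support, (v : E) ∈ s) →
      ∃ w : E → ℝ, (∀ v : Ω, w v = c v) ∧ (∀ v, 0 ≤ w v) ∧ (∀ v ∉ s, w v = 0) ∧
        ∑ v ∈ s, w v = 1 ∧ ∑ v ∈ s, w v • v = (ω : E) := by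
    intro c hc s hs hcs
    let w : E → ℝ := fun v => if h : v ∈ Ω then c ⟨v, h⟩ else 0
    have hwc : ∀ v : Ω, w v = c v := fun v => by simp [w]
    have hws : ∀ v ∉ s, w v = 0 := fun v hv => by
      by_cases h : v ∈ Ω
      · by_contra hne
        exact hv (hcs ⟨v, h⟩ (Finsupp.mem_support_iff.2 (by simpa [w, h] using hne)))
      · simp [w, h]
    have hsum : ∀ f : E → ℝ × E,
        ∑ v ∈ s, w v • f v = c.sum fun v a => a • f v := by
      intro f
      rw [Finsupp.sum, ← Finset.sum_subset (s₁ := c.support.map ⟨_, Subtype.val_injective⟩)]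
      · rw [Finset.sum_map]
        exact Finset.sum_congr rfl fun v _ => by simp [hwc]
      · intro v hv
        obtain ⟨u, hu, rfl⟩ := Finset.mem_map.1 hv
        exact hcs u hu
      · intro v _ hv
        have : w v = 0 := by
          by_cases h : v ∈ Ω
          · by_contra hne
            exact hv (Finset.mem_map.2 ⟨⟨v, h⟩,
              Finsupp.mem_support_iff.2 (by simpa [w, h] using hne), rfl⟩)
          · simp [w, h]
        rw [this, zero_smul]
    refine ⟨w, hwc, fun v => ?_, hws, ?_, ?_⟩
    · by_cases h : v ∈ Ω
      · simpa [w, h] using hc.nonneg ⟨v, h⟩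
      · simp [w, h]
    · have := congrArg Prod.fst (hsum fun v => (1, v))
      rw [← hc.total]
      simpa [Finsupp.sum, Prod.fst_sum] using this
    · have := congrArg Prod.snd (hsum fun v => (1, v))
      rw [← hc.center]
      simpa [Finsupp.sum, Prod.snd_sum] using this
  obtain ⟨s, hs, hcs⟩ := hc.face
  obtain ⟨t, ht, hdt⟩ := hd.face
  obtain ⟨w, hw, hw0, hws, hw1, hwω⟩ := key hc hs hcs
  obtain ⟨z, hz, hz0, hzt, hz1, hzω⟩ := key hd ht hdt
  have hmem : (ω : E) ∈ convexHull ℝ ((s ∩ t : Finset E) : Set E) := by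
    rw [Finset.coe_inter]
    exact γ.inter_subset_convexHull hs ht
      ⟨Finset.mem_convexHull'.2 ⟨w, fun v _ => hw0 v, hw1, hwω⟩,
        Finset.mem_convexHull'.2 ⟨z, fun v _ => hz0 v, hz1, hzω⟩⟩
  obtain ⟨y, hy0, hy1, hyω⟩ := Finset.mem_convexHull'.1 hmem
  let y' : E → ℝ := fun v => if v ∈ s ∩ t then y v else 0
  have hy's : ∀ {r : Finset E}, s ∩ t ⊆ r → ∑ v ∈ r, y' v = 1 ∧ ∑ v ∈ r, y' v • v = (ω : E) := by
    intro r hr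
    constructor
    · rw [← hy1, ← Finset.sum_subset hr (fun v _ hv => by simp only [y', if_neg hv])]
      exact Finset.sum_congr rfl fun v hv => by simp only [y', if_pos hv]
    · rw [← hyω, ← Finset.sum_subset hr (fun v _ hv => by simp only [y', if_neg hv, zero_smul])]
      exact Finset.sum_congr rfl fun v hv => by simp only [y', if_pos hv]
  have indep : ∀ {r : Finset E}, r ∈ γ.faces → ∀ {p q : E → ℝ},
      ∑ v ∈ r, p v = 1 → ∑ v ∈ r, q v = 1 → ∑ v ∈ r, p v • v = (ω : E) →
      ∑ v ∈ r, q v • v = (ω : E) → ∀ v ∈ r, p v = q v := by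
    intro r hr p q hp hq hpω hqω v hv
    have h := (affineIndependent_iff (k := ℝ)).1 (γ.indep hr) Finset.univ
      (fun i => p i - q i)
      (by rw [Finset.univ_eq_attach, Finset.sum_attach r (fun v => p v - q v),
            Finset.sum_sub_distrib, hp, hq, sub_self])
      (by
        have := Finset.sum_attach r (fun v => (p v - q v) • v)
        rw [Finset.univ_eq_attach, this]
        simp only [sub_smul]
        rw [Finset.sum_sub_distrib, hpω, hqω, sub_self])
      ⟨v, hv⟩ (Finset.mem_univ _)
    simpa [sub_eq_zero] using h
  obtain ⟨a1, a2⟩ := hy's (r := s) Finset.inter_subset_left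
  obtain ⟨b1, b2⟩ := hy's (r := t) Finset.inter_subset_right
  have hwy : ∀ v, w v = y' v := fun v => by
    by_cases hv : v ∈ s
    · exact indep hs hw1 a1 hwω a2 v hv
    · rw [hws v hv]; simp [y', hv]
  have hzy : ∀ v, z v = y' v := fun v => by
    by_cases hv : v ∈ t
    · exact indep ht hz1 b1 hzω b2 v hv
    · rw [hzt v hv]; simp [y', hv]
  ext v
  rw [← hw, ← hz, hwy, hzy]

/-- `ℂ(ω, γ)`: the unique representation of `ω` as a convex combination of the vertices of a
simplex of `γ`, as a finitely supported measure. -/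
def Triangulation.splitting (γ : Triangulation Ω) (ω : Ω) : Ω →₀ ℝ :=
  (exists_isBarycentric γ ω).choose

/-- `𝕀(f, γ)`: the linear interpolation of `f` based on `γ`. -/
def interpolate (f : Ω → ℝ) (γ : Triangulation Ω) (ω : Ω) : ℝ :=
  (γ.splitting ω).sum fun v a => a * f v

/-- `cvxg(f)`: the convex hull of the graph of `f`. -/
def convexGraph (f : Ω → ℝ) : Set (E × ℝ) :=
  convexHull ℝ (Set.range fun ω : Ω => ((ω : E), f ω))

/-- `cav(f)`: the concave closure of `f`. -/
def concaveClosure (f : Ω → ℝ) (ω : Ω) : ℝ :=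
  sSup {z : ℝ | ((ω : E), z) ∈ convexGraph f}

/-- `arg cav(f)`: the triangulations whose interpolation of `f` is the concave closure of `f`. -/
def argCav (f : Ω → ℝ) : Set (Triangulation Ω) :=
  {γ | interpolate f γ = concaveClosure f}

end Geometry

/-! ### The game -/

/-- Probability distributions on a finite set. -/
abbrev Prob (α : Type*) [Fintype α] := ↥(stdSimplex ℝ α)

/-- The principal `A` and the receiver `B`. -/
inductive Player
  | A
  | B

/-- The data of the game. Stages are numbered `0, …, T - 1`. At stage `t` the state lies in
`X t`, the receiver's action in `U t` and the outcome of the experiment in `M t`. The actions in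
`quit t` terminate the game. -/
structure SignalGame (X U M : ℕ → Type*) [∀ t, Fintype (X t)] where
  T : ℕ
  prior : Prob (X 0)
  trans : ∀ t, X t → U t → Prob (X (t + 1))
  reward : Player → ∀ t, X t → U t → ℝ
  quit : ∀ t, Set (U t)

/-- State trajectories up to and including stage `t`. -/
def Traj (X : ℕ → Type*) : ℕ → Type _
  | 0 => X 0
  | t + 1 => Traj X t × X (t + 1)

/-- The current (last) state of a trajectory. -/
def Traj.last {X : ℕ → Type*} : ∀ {t : ℕ}, Traj X t → X t
  | 0, x => x
  | _ + 1, x => x.2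

instance Traj.instFintype {X : ℕ → Type*} [∀ t, Fintype (X t)] : ∀ t, Fintype (Traj X t)
  | 0 => inferInstanceAs (Fintype (X 0))
  | t + 1 =>
    haveI := Traj.instFintype (X := X) t
    inferInstanceAs (Fintype (Traj X t × X (t + 1)))

variable {X U M : ℕ → Type*} [∀ t, Fintype (X t)] [∀ t, Fintype (M t)]

/-- Experiments at stage `t`: observation kernels from states to outcomes. -/
abbrev Experiment (X M : ℕ → Type*) [∀ t, Fintype (M t)] (t : ℕ) := X t → Prob (M t)

/-- Information of the principal at the start of stage `t`, the game still going on: the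
experiments, outcomes and (non-terminating) actions of the earlier stages. -/
inductive HistA (G : SignalGame X U M) : ℕ → Type _
  | nil : HistA G 0
  | next {t : ℕ} (h : HistA G t) (σ : Experiment X M t) (m : M t) (u : U t)
      (hu : u ∉ G.quit t) : HistA G (t + 1)

/-- Information of the receiver when choosing the action of stage `t`. -/
structure HistB (G : SignalGame X U M) (t : ℕ) where
  past : HistA G t
  exper : Experiment X M t
  outcome : M t

/-- The receiver's history `k` followed by a non-terminating action. -/
def HistB.act {G : SignalGame X U M} {t : ℕ} (k : HistB G t) (u : U t) (hu : u ∉ G.quit t) :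
    HistA G (t + 1) :=
  HistA.next k.past k.exper k.outcome u hu

/-- Pure strategies of the principal. -/
abbrev StratA (G : SignalGame X U M) := ∀ t, HistA G t → Experiment X M t

/-- Pure strategies of the receiver. -/
abbrev StratB (G : SignalGame X U M) := ∀ t, HistB G t → U t

/-! ### The law of the play and the payoffs

All laws are finitely supported measures. The law of (trajectory, history) at stage `t` only
carries the mass of the plays that have not terminated before stage `t`. -/

variable {G : SignalGame X U M}

/-- The experiment of stage `t` is chosen by `gA` and its outcome is drawn. -/
def observe (gA : StratA G) {t : ℕ} (ν : (Traj X t × HistA G t) →₀ ℝ) :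
    (Traj X t × HistB G t) →₀ ℝ :=
  ν.sum fun n p => ∑ m : M t,
    Finsupp.single (n.1, ⟨n.2, gA t n.2, m⟩) (p * gA t n.2 n.1.last m)

open Classical in
/-- The action of stage `t` is chosen by `gB`; if it does not terminate the game, the next
state is drawn. -/
def advance (gB : StratB G) {t : ℕ} (ν : (Traj X t × HistB G t) →₀ ℝ) :
    (Traj X (t + 1) × HistA G (t + 1)) →₀ ℝ :=
  ν.sum fun n p =>
    if hu : gB t n.2 ∈ G.quit t then 0
    else ∑ x' : X (t + 1),
      Finsupp.single ((n.1, x'), n.2.act (gB t n.2) hu)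
        (p * G.trans t n.1.last (gB t n.2) x')

/-- The law at stage `t` (after the outcome of the experiment is known) of the play that starts
at stage `τ` from the law `ν` and follows `(gA, gB)`; it is zero for `t < τ`. -/
def playLaw (gA : StratA G) (gB : StratB G) (τ : ℕ) (ν : (Traj X τ × HistB G τ) →₀ ℝ) :
    ∀ t : ℕ, (Traj X t × HistB G t) →₀ ℝ
  | 0 => (Pi.single τ ν : ∀ t, (Traj X t × HistB G t) →₀ ℝ) 0
  | t + 1 => (Pi.single τ ν : ∀ t, (Traj X t × HistB G t) →₀ ℝ) (t + 1) +
      observe gA (advance gB (playLaw gA gB τ ν t))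

/-- The law of (trajectory, history) with known history `h` and trajectory distributed as `p`. -/
def atHist {H : Type*} {t : ℕ} (p : Prob (Traj X t)) (h : H) : (Traj X t × H) →₀ ℝ :=
  ∑ x : Traj X t, Finsupp.single (x, h) (p x)

/-- Expected total reward of player `i` from stage `τ` on, when play starts from the law `ν`. -/
def rewardFrom (i : Player) (gA : StratA G) (gB : StratB G) (τ : ℕ)
    (ν : (Traj X τ × HistB G τ) →₀ ℝ) : ℝ :=
  ∑ t ∈ Finset.Ico τ G.T,
    (playLaw gA gB τ ν t).sum fun n p => p * G.reward i t n.1.last (gB t n.2)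

/-- Expected reward-to-go of player `i` at a history of the receiver, under the belief `p`. -/
def payoffAtB (i : Player) (gA : StratA G) (gB : StratB G) {τ : ℕ} (p : Prob (Traj X τ))
    (k : HistB G τ) : ℝ :=
  rewardFrom i gA gB τ (atHist p k)

/-- Expected reward-to-go of player `i` at a history of the principal, under the belief `p`. -/
def payoffAtA (i : Player) (gA : StratA G) (gB : StratB G) {τ : ℕ} (p : Prob (Traj X τ))
    (h : HistA G τ) : ℝ :=
  rewardFrom i gA gB τ (observe gA (atHist p h))

/-- `J^i(g)`: the expected total reward of player `i` in the whole game. -/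
def payoff (i : Player) (gA : StratA G) (gB : StratB G) : ℝ :=
  payoffAtA i gA gB (τ := 0) G.prior HistA.nil

/-! ### Perfect Bayesian equilibrium -/

/-- A belief system: distributions of the state trajectory given the players' information. -/
structure BeliefSystem (G : SignalGame X U M) where
  A : ∀ t, HistA G t → Prob (Traj X t)
  B : ∀ t, HistB G t → Prob (Traj X t)

/-- No player gains by changing their strategy from any of their histories on, given the belief
there. -/
structure SequentiallyRational (gA : StratA G) (gB : StratB G) (μ : BeliefSystem G) : Prop where
  principal : ∀ t < G.T, ∀ (h : HistA G t) (gA' : StratA G),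
    payoffAtA .A gA' gB (μ.A t h) h ≤ payoffAtA .A gA gB (μ.A t h) h
  receiver : ∀ t < G.T, ∀ (k : HistB G t) (gB' : StratB G),
    payoffAtB .B gA gB' (μ.B t k) k ≤ payoffAtB .B gA gB (μ.B t k) k

/-- Beliefs are updated by Bayes' law whenever the denominator is non-zero. Strategies are
functions of the public history, so the probability of choosing an experiment or an action does
not depend on the state and cancels in Bayes' law. The update is required after every announced
experiment and every action, in particular after deviations. -/
structure BayesConsistent (μ : BeliefSystem G) : Prop where
  initial : μ.A 0 HistA.nil = G.prior
  outcome : ∀ t < G.T, ∀ k : HistB G t,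
    (∑ y, μ.A t k.past y * k.exper y.last k.outcome) ≠ 0 →
    ∀ x, μ.B t k x = μ.A t k.past x * k.exper x.last k.outcome /
      ∑ y, μ.A t k.past y * k.exper y.last k.outcome
  action : ∀ t, t + 1 < G.T → ∀ (k : HistB G t) (u : U t) (hu : u ∉ G.quit t)
    (x : Traj X t) (x' : X (t + 1)),
    μ.A (t + 1) (k.act u hu) (x, x') = μ.B t k x * G.trans t x.last u x'

/-- Perfect Bayesian equilibrium. -/
structure IsPBE (gA : StratA G) (gB : StratB G) (μ : BeliefSystem G) : Prop where
  rational : SequentiallyRational gA gB μ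
  consistent : BayesConsistent μ

/-! ### Canonical beliefs and canonical belief based strategies -/

/-- The uniform distribution. -/
def uniform (α : Type*) [Fintype α] [Nonempty α] : Prob α :=
  ⟨fun _ => (Fintype.card α : ℝ)⁻¹, fun _ => by positivity, by simp⟩

open Classical in
/-- The Bayesian update `ξ(π, σ, m)`; uniform if the denominator is zero. -/
def bayesUpdate {α β : Type*} [Fintype α] [Nonempty α] [Fintype β] (π : Prob α)
    (σ : α → Prob β) (m : β) : Prob α :=
  if h : ∑ y, π y * σ y m = 0 then uniform α
  else ⟨fun x => π x * σ x m / ∑ y, π y * σ y m,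
    fun x => div_nonneg (mul_nonneg (π.2.1 x) ((σ x).2.1 m))
      (Finset.sum_nonneg fun y _ => mul_nonneg (π.2.1 y) ((σ y).2.1 m)),
    by rw [← Finset.sum_div, div_self h]⟩

/-- `ℓ_t(π, u)`: the distribution of the next state. -/
def nextBelief (G : SignalGame X U M) (t : ℕ) (π : Prob (X t)) (u : U t) : Prob (X (t + 1)) :=
  ⟨fun x' => ∑ x, π x * G.trans t x u x',
    fun x' => Finset.sum_nonneg fun x _ => mul_nonneg (π.2.1 x) ((G.trans t x u).2.1 x'),
    by
      rw [Finset.sum_comm]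
      have h : ∀ x, ∑ x', π x * G.trans t x u x' = π x := fun x => by
        rw [← Finset.mul_sum]
        have := (G.trans t x u).2.2
        exact (congrArg (π x * ·) this).trans (mul_one _)
      simp only [h]
      exact π.2.2⟩

variable [∀ t, Nonempty (X t)]

/-- The canonical belief `κ^A_t` of the principal. -/
def canonA : ∀ {t : ℕ}, HistA G t → Prob (X t)
  | _, .nil => G.prior
  | _, .next (t := t) h σ m u _ => nextBelief G t (bayesUpdate (canonA h) σ m) u

/-- The canonical belief `κ^B_t` of the receiver. -/
def canonB {t : ℕ} (k : HistB G t) : Prob (X t) :=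
  bayesUpdate (canonA k.past) k.exper k.outcome

/-- The strategy of the principal given by a canonical belief based strategy. -/
def cbbA (G : SignalGame X U M) (lA : ∀ t, Prob (X t) → Experiment X M t) : StratA G :=
  fun t h => lA t (canonA h)

/-- The strategy of the receiver given by a canonical belief based strategy. -/
def cbbB (G : SignalGame X U M) (lB : ∀ t, Prob (X t) → U t) : StratB G :=
  fun t k => lB t (canonB k)

open Classical in
/-- The experiment `σ` induces the finitely supported distribution `η` of posteriors from `π`. -/
def Induces {α β : Type*} [Fintype α] [Nonempty α] [Fintype β] (σ : α → Prob β)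
    (η : Prob α →₀ ℝ) (π : Prob α) : Prop :=
  ∀ ρ : Prob α, η ρ = ∑ m, (if ρ = bayesUpdate π σ m then 1 else 0) * ∑ x, σ x m * π x

/-! ### The backward recursion -/

section Recursion

open Classical in
/-- `q̂^i_t(π, u)`: the continuation value is zero after a terminating action. -/
def qHat (G : SignalGame X U M) (V : Player → ∀ t, Prob (X t) → ℝ) (i : Player) (t : ℕ)
    (π : Prob (X t)) (u : U t) : ℝ :=
  ∑ x, G.reward i t x u * π x +
    if u ∈ G.quit t then 0 else V i (t + 1) (nextBelief G t π u)

/-- `Υ_t(π)`: the actions that maximize `q̂^B_t(π, ·)`. -/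
def bestActions (G : SignalGame X U M) (V : Player → ∀ t, Prob (X t) → ℝ) (t : ℕ)
    (π : Prob (X t)) : Set (U t) :=
  {u | ∀ u', qHat G V .B t π u' ≤ qHat G V .B t π u}

/-- `v̂^i_t(π)`: for the receiver the maximum of `q̂^B_t(π, ·)` over all actions, for the
principal the maximum of `q̂^A_t(π, ·)` over `Υ_t(π)`. -/
def vHat (G : SignalGame X U M) (V : Player → ∀ t, Prob (X t) → ℝ) :
    Player → ∀ t, Prob (X t) → ℝ
  | .A, t, π => sSup (qHat G V .A t π '' bestActions G V t π)
  | .B, t, π => sSup (Set.range (qHat G V .B t π))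

/-- The value functions `V`, the triangulations `γ` and the canonical belief based strategies
`(lA, lB)` are an outcome of the backward recursion. -/
structure IsRecursionOutcome (G : SignalGame X U M) (V : Player → ∀ t, Prob (X t) → ℝ)
    (γ : ∀ t, Triangulation (stdSimplex ℝ (X t)))
    (lA : ∀ t, Prob (X t) → Experiment X M t) (lB : ∀ t, Prob (X t) → U t) : Prop where
  terminal : ∀ i π, V i G.T π = 0
  triangulation : ∀ t < G.T, γ t ∈ argCav (vHat G V .A t)
  value : ∀ t < G.T, ∀ i, V i t = interpolate (vHat G V i t) (γ t)
  action : ∀ t < G.T, ∀ π, lB t π ∈ bestActions G V t π ∧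
    qHat G V .A t π (lB t π) = vHat G V .A t π
  experiment : ∀ t < G.T, ∀ π, Induces (lA t π) ((γ t).splitting π) π

end Recursion

end SignalPicking

end

noncomputable section

namespace SignalPicking

/-! ### Bayesian updates and concave closures -/

section Update

variable {α β : Type*} [Fintype α] [Nonempty α] [Fintype β]

/-! Canonical beliefs depend on the public history alone, not on the strategies, so a deviation
never changes how a given history is interpreted. They lift to distributions of the whole trajectory
(`canonTrajA`, `canonTrajB`) that satisfy Bayes' law by construction. Since rewards, experiments and
transitions see only the last state, payoffs depend on these lifts only through `canonA` and
`canonB` (`hasLast_canonTrajA`, `hasLast_canonTrajB`).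

Payoffs are linear in the initial law, which gives a dynamic programming recursion for arbitrary
strategies (`payoffAtA_eq`, `payoffAtB_eq`). Backward induction then does the rest. Under the given
strategies the payoffs are `V`, because the experiment induces the splitting that defines the
interpolation (`value_eq`). Against `lB`, any experiment splits the belief into posteriors with mean
equal to the belief, so its average of `vHat` is at most the concave closure, which is `V .A`
(`sum_mass_mul_vHat_le`). Against `lA`, an action yields the receiver at most `vHat .B`, and
averaging over the unchanged experiment gives `V .B`. These bounds cover deviations at all later
histories at once, so no one-shot deviation principle is needed. -/

theorem Prob.nonneg {α : Type*} [Fintype α] (π : Prob α) (x : α) : 0 ≤ π x := π.2.1 x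

theorem Prob.sum_eq_one {α : Type*} [Fintype α] (π : Prob α) : ∑ x, π x = 1 := π.2.2

theorem bayesUpdate_of_ne {π : Prob α} {σ : α → Prob β} {m : β}
    (h : ∑ y, π y * σ y m ≠ 0) (x : α) :
    bayesUpdate π σ m x = π x * σ x m / ∑ y, π y * σ y m := by
  rw [bayesUpdate, dif_neg h]
  rfl

theorem bayesUpdate_of_eq {π : Prob α} {σ : α → Prob β} {m : β}
    (h : ∑ y, π y * σ y m = 0) : bayesUpdate π σ m = uniform α := by
  rw [bayesUpdate, dif_pos h]

theorem mul_eq_zero_of_mass_eq_zero {α β : Type*} [Fintype α] [Fintype β]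
    {π : Prob α} {σ : α → Prob β} {m : β}
    (h : ∑ y, π y * σ y m = 0) (x : α) : π x * σ x m = 0 :=
  (Finset.sum_eq_zero_iff_of_nonneg
    (fun y _ => mul_nonneg (π.nonneg y) ((σ y).nonneg m))).1 h x (Finset.mem_univ x)

/-- Bayes' law without division: for an outcome of mass zero both sides vanish, so the uniform
convention never matters in averages. -/
theorem mass_mul_bayesUpdate (π : Prob α) (σ : α → Prob β) (m : β) (x : α) :
    (∑ y, π y * σ y m) * bayesUpdate π σ m x = π x * σ x m := by
  by_cases h : ∑ y, π y * σ y m = 0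
  · rw [h, zero_mul, mul_eq_zero_of_mass_eq_zero h]
  · rw [bayesUpdate_of_ne h, mul_div_cancel₀ _ h]

omit [Nonempty α] in
theorem mass_nonneg (π : Prob α) (σ : α → Prob β) (m : β) : 0 ≤ ∑ y, π y * σ y m :=
  Finset.sum_nonneg fun y _ => mul_nonneg (π.nonneg y) ((σ y).nonneg m)

omit [Nonempty α] in
theorem sum_mass (π : Prob α) (σ : α → Prob β) : ∑ m, ∑ y, π y * σ y m = 1 := by
  rw [Finset.sum_comm]
  simp only [← Finset.mul_sum, Prob.sum_eq_one, mul_one]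

/-- Grouping outcomes by their posterior turns the sum over outcomes into the sum over vertices. The
support is enlarged by all posteriors so that each indicator selects exactly one term. -/
theorem interpolate_eq_of_induces {f : Prob α → ℝ} {γ : Triangulation (stdSimplex ℝ α)}
    {π : Prob α} {σ : α → Prob β} (h : Induces σ (γ.splitting π) π) :
    interpolate f γ π = ∑ m, (∑ y, π y * σ y m) * f (bayesUpdate π σ m) := by
  classical
  have hsub : (γ.splitting π).support ⊆
      (γ.splitting π).support ∪ Finset.univ.image (bayesUpdate π σ) :=
    Finset.subset_union_left
  rw [interpolate, Finsupp.sum_of_support_subset _ hsub _ (by simp)]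
  simp only [h _, Finset.sum_mul]
  rw [Finset.sum_comm]
  refine Finset.sum_congr rfl fun m _ => ?_
  rw [Finset.sum_eq_single_of_mem (bayesUpdate π σ m)
    (Finset.mem_union_right _ (Finset.mem_image_of_mem _ (Finset.mem_univ m)))]
  · simp only [if_true, one_mul, ← Finset.sum_mul]
    simp only [mul_comm]
  · intro ρ _ hρ
    simp [hρ]

/-- The posteriors average back to the prior, so the prior paired with the averaged value is a
convex combination of points of the graph. -/
theorem sum_mass_mul_le_concaveClosure {f : Prob α → ℝ} {C : ℝ} (hf : ∀ ρ, f ρ ≤ C)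
    (π : Prob α) (σ : α → Prob β) :
    ∑ m, (∑ y, π y * σ y m) * f (bayesUpdate π σ m) ≤ concaveClosure f π := by
  -- The real `sSup` needs a bounded set: the half-space below height `C` contains the graph, hence
  -- its hull.
  refine le_csSup ⟨C, fun z hz => ?_⟩ ?_
  · have hconv : Convex ℝ {p : (α → ℝ) × ℝ | p.2 ≤ C} :=
      convex_halfSpace_le (LinearMap.snd ℝ (α → ℝ) ℝ).isLinear C
    exact convexHull_min (by rintro _ ⟨ρ, rfl⟩; exact hf ρ) hconv hz
  · have hmem := (convex_convexHull ℝ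
      (Set.range fun ρ : Prob α => ((ρ : α → ℝ), f ρ))).sum_mem
      (t := Finset.univ) (w := fun m => ∑ y, π y * σ y m)
      (z := fun m => ((bayesUpdate π σ m : α → ℝ), f (bayesUpdate π σ m)))
      (fun m _ => mass_nonneg π σ m) (sum_mass π σ)
      (fun m _ => subset_convexHull ℝ _ ⟨_, rfl⟩)
    suffices hsum : ((π : α → ℝ), ∑ m, (∑ y, π y * σ y m) * f (bayesUpdate π σ m)) =
        ∑ m, (∑ y, π y * σ y m) • ((bayesUpdate π σ m : α → ℝ), f (bayesUpdate π σ m)) by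
      rw [← hsum] at hmem
      exact hmem
    refine Prod.ext ?_ ?_
    · funext x
      simp only [Prod.fst_sum, Prod.smul_fst, Finset.sum_apply, Pi.smul_apply, smul_eq_mul]
      refine ((Finset.sum_congr rfl fun m _ => mass_mul_bayesUpdate π σ m x).trans ?_).symm
      rw [← Finset.mul_sum, Prob.sum_eq_one, mul_one]
    · simp [Prod.snd_sum]

end Update

/-! ### Beliefs about trajectories -/

section Trajectories

variable {X U M : ℕ → Type*} [∀ t, Fintype (X t)]

theorem Traj.sum_succ {t : ℕ} (f : Traj X (t + 1) → ℝ) :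
    ∑ y, f y = ∑ x : Traj X t, ∑ x' : X (t + 1), f (x, x') :=
  Fintype.sum_prod_type (f := f)

/-- The last state of a trajectory with distribution `p` has distribution `π`. -/
def HasLast {t : ℕ} (p : Prob (Traj X t)) (π : Prob (X t)) : Prop :=
  ∀ f : X t → ℝ, ∑ y, p y * f y.last = ∑ x, π x * f x

/-- The distribution of the trajectory extended by the state that follows the action `u`. -/
def nextTraj (G : SignalGame X U M) {t : ℕ} (p : Prob (Traj X t)) (u : U t) :
    Prob (Traj X (t + 1)) :=
  ⟨fun y => p y.1 * G.trans t y.1.last u y.2,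
    fun y => mul_nonneg (p.nonneg _) ((G.trans t _ u).nonneg _), by
      rw [Traj.sum_succ]
      simp only [← Finset.mul_sum, Prob.sum_eq_one, mul_one]⟩

/-- The transition depends on the trajectory only through its last state. -/
theorem HasLast.nextTraj {G : SignalGame X U M} {t : ℕ} {p : Prob (Traj X t)}
    {π : Prob (X t)} (h : HasLast p π) (u : U t) :
    HasLast (nextTraj G p u) (nextBelief G t π u) := by
  intro f
  have h1 := h fun x => ∑ x', G.trans t x u x' * f x'
  rw [Traj.sum_succ]
  have h2 : ∀ x', nextBelief G t π u x' = ∑ x, π x * G.trans t x u x' := fun _ => rfl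
  have h3 : ∀ (x : Traj X t) (x' : X (t + 1)), SignalPicking.nextTraj G p u (x, x') =
    p x * G.trans t x.last u x' := fun _ _ => rfl
  simp only [h2, h3, Finset.sum_mul, mul_assoc]
  rw [Finset.sum_comm (s := (Finset.univ : Finset (X (t + 1))))]
  simp only [← Finset.mul_sum]
  exact h1

variable [∀ t, Nonempty (X t)]

/-- A trajectory that ends at a given state. -/
def Traj.ofLast : ∀ {t : ℕ}, X t → Traj X t
  | 0, x => x
  | _ + 1, x => (Traj.ofLast (Classical.arbitrary _), x)

omit [∀ t, Fintype (X t)] in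
theorem Traj.last_ofLast : ∀ {t : ℕ} (x : X t), (Traj.ofLast x).last = x
  | 0, _ => rfl
  | _ + 1, _ => rfl

instance Traj.instNonempty (t : ℕ) : Nonempty (Traj X t) :=
  ⟨Traj.ofLast (Classical.arbitrary _)⟩

open Classical in
/-- A distribution of trajectories with uniformly distributed last state. -/
def uniformLast (X : ℕ → Type*) [∀ t, Fintype (X t)] [∀ t, Nonempty (X t)] (t : ℕ) :
    Prob (Traj X t) :=
  ⟨fun y => ∑ x, if Traj.ofLast x = y then uniform (X t) x else 0,
    fun y => Finset.sum_nonneg fun x _ => by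
      split_ifs
      · exact Prob.nonneg _ _
      · exact le_rfl,
    by
      rw [Finset.sum_comm]
      simp⟩

theorem hasLast_uniformLast (t : ℕ) : HasLast (uniformLast X t) (uniform (X t)) := by
  classical
  intro f
  have h : ∀ y, uniformLast X t y =
      ∑ x, if Traj.ofLast x = y then uniform (X t) x else 0 := fun y => by
    refine Finset.sum_congr rfl fun x _ => ?_
    congr
  simp only [h, Finset.sum_mul]
  rw [Finset.sum_comm]
  simp [ite_mul, Traj.last_ofLast]

variable [∀ t, Fintype (M t)]

open Classical in
/-- The update of a distribution of trajectories by the outcome `m` of the experiment `σ`; an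
outcome of probability zero makes the last state uniform. -/
def posteriorTraj {t : ℕ} (p : Prob (Traj X t)) (σ : Experiment X M t) (m : M t) :
    Prob (Traj X t) :=
  if ∑ y, p y * σ y.last m = 0 then uniformLast X t
  else bayesUpdate p (fun y => σ y.last) m

theorem posteriorTraj_of_ne {t : ℕ} {p : Prob (Traj X t)} {σ : Experiment X M t} {m : M t}
    (h : ∑ y, p y * σ y.last m ≠ 0) (x : Traj X t) :
    posteriorTraj p σ m x = p x * σ x.last m / ∑ y, p y * σ y.last m := by
  rw [posteriorTraj, if_neg h]
  exact bayesUpdate_of_ne (σ := fun y : Traj X t => σ y.last) h x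

theorem mass_mul_posteriorTraj {t : ℕ} (p : Prob (Traj X t)) (σ : Experiment X M t) (m : M t)
    (x : Traj X t) :
    (∑ y, p y * σ y.last m) * posteriorTraj p σ m x = p x * σ x.last m := by
  by_cases h : ∑ y, p y * σ y.last m = 0
  · rw [h, zero_mul]
    exact (mul_eq_zero_of_mass_eq_zero (σ := fun y : Traj X t => σ y.last) h x).symm
  · rw [posteriorTraj_of_ne h, mul_div_cancel₀ _ h]

/-- The likelihood depends only on the last state, so Bayes' law commutes with taking the marginal.
For null outcomes both conventions make the last state uniform. -/
theorem HasLast.posteriorTraj {t : ℕ} {p : Prob (Traj X t)} {π : Prob (X t)}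
    (h : HasLast p π) (σ : Experiment X M t) (m : M t) :
    HasLast (posteriorTraj p σ m) (bayesUpdate π σ m) := by
  have hD : ∑ y, p y * σ y.last m = ∑ x, π x * σ x m := h fun x => σ x m
  by_cases h0 : ∑ x, π x * σ x m = 0
  · rw [bayesUpdate_of_eq h0, SignalPicking.posteriorTraj, if_pos (hD.trans h0)]
    exact hasLast_uniformLast t
  · intro f
    have h1 := h fun x => σ x m * f x
    have h0' := h0
    rw [← hD] at h0'
    simp only [posteriorTraj_of_ne h0', bayesUpdate_of_ne h0, hD, div_mul_eq_mul_div,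
      ← Finset.sum_div, mul_assoc]
    rw [h1]

variable {G : SignalGame X U M}

/-- The canonical belief of the principal about the trajectory. -/
def canonTrajA : ∀ {t : ℕ}, HistA G t → Prob (Traj X t)
  | _, .nil => G.prior
  | _, .next h σ m u _ => nextTraj G (posteriorTraj (canonTrajA h) σ m) u

/-- The canonical belief of the receiver about the trajectory. -/
def canonTrajB {t : ℕ} (k : HistB G t) : Prob (Traj X t) :=
  posteriorTraj (canonTrajA k.past) k.exper k.outcome

theorem canonA_act {t : ℕ} (k : HistB G t) (u : U t) (hu : u ∉ G.quit t) :
    canonA (k.act u hu) = nextBelief G t (canonB k) u := rfl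

theorem hasLast_canonTrajA : ∀ {t : ℕ} (h : HistA G t), HasLast (canonTrajA h) (canonA h)
  | _, .nil => fun _ => rfl
  | _, .next h σ m u _ => ((hasLast_canonTrajA h).posteriorTraj σ m).nextTraj u

theorem hasLast_canonTrajB {t : ℕ} (k : HistB G t) : HasLast (canonTrajB k) (canonB k) :=
  (hasLast_canonTrajA k.past).posteriorTraj _ _

/-- The belief system of canonical beliefs about the trajectory. -/
def canonBeliefs (G : SignalGame X U M) : BeliefSystem G :=
  ⟨fun _ h => canonTrajA h, fun _ k => canonTrajB k⟩

theorem bayesConsistent_canonBeliefs : BayesConsistent (canonBeliefs G) where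
  initial := rfl
  outcome _ _ _ hD x := posteriorTraj_of_ne hD x
  action _ _ _ _ _ _ _ := rfl

end Trajectories

/-! ### One-step recursion of the payoffs -/

section Payoffs

variable {X U M : ℕ → Type*} [∀ t, Fintype (X t)] [∀ t, Fintype (M t)] {G : SignalGame X U M}

/-! ### Linearity in the initial law. -/

theorem isLinearMap_finsuppSum {ι N : Type*} [AddCommGroup N] [Module ℝ N] (f : ι → ℝ → N)
    (hadd : ∀ i a b, f i (a + b) = f i a + f i b) (hsmul : ∀ i c a, f i (c * a) = c • f i a) :
    IsLinearMap ℝ fun ν : ι →₀ ℝ => ν.sum f := by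
  have h0 : ∀ i, f i 0 = 0 := fun i => by simpa using hsmul i 0 0
  refine ⟨fun a b => Finsupp.sum_add_index' h0 hadd, fun c a => ?_⟩
  rw [Finsupp.sum_smul_index h0]
  simp only [hsmul, Finsupp.smul_sum]

theorem isLinearMap_observe (gA : StratA G) (t : ℕ) :
    IsLinearMap ℝ (observe gA (t := t)) := by
  refine isLinearMap_finsuppSum _ (fun n a b => ?_) (fun n c a => ?_)
  · simp only [add_mul, Finsupp.single_add, Finset.sum_add_distrib]
  · simp only [mul_assoc, Finset.smul_sum, Finsupp.smul_single, smul_eq_mul]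

theorem isLinearMap_advance (gB : StratB G) (t : ℕ) :
    IsLinearMap ℝ (advance gB (t := t)) := by
  refine isLinearMap_finsuppSum _ (fun n a b => ?_) (fun n c a => ?_)
  · split_ifs
    · simp
    · simp only [add_mul, Finsupp.single_add, Finset.sum_add_distrib]
  · split_ifs
    · simp
    · simp only [mul_assoc, Finset.smul_sum, Finsupp.smul_single, smul_eq_mul]

theorem isLinearMap_playLaw (gA : StratA G) (gB : StratB G) (τ t : ℕ) :
    IsLinearMap ℝ fun ν => playLaw gA gB τ ν t := by
  induction t with
  | zero =>
    refine ⟨fun a b => ?_, fun c a => ?_⟩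
    · simp only [playLaw, Pi.single_add, Pi.add_apply]
    · simp only [playLaw, Pi.single_smul, Pi.smul_apply]
  | succ t ih =>
    have h := (isLinearMap_observe gA (t + 1))
    have h' := (isLinearMap_advance gB t)
    refine ⟨fun a b => ?_, fun c a => ?_⟩
    · simp only [playLaw, Pi.single_add, Pi.add_apply]
      rw [ih.map_add, h'.map_add, h.map_add]
      abel
    · simp only [playLaw, Pi.single_smul, Pi.smul_apply]
      rw [ih.map_smul, h'.map_smul, h.map_smul, smul_add]

theorem isLinearMap_rewardFrom (i : Player) (gA : StratA G) (gB : StratB G) (τ : ℕ) :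
    IsLinearMap ℝ (rewardFrom i gA gB τ) := by
  have h : ∀ t, IsLinearMap ℝ fun ν : (Traj X t × HistB G t) →₀ ℝ =>
      ν.sum fun n p => p * G.reward i t n.1.last (gB t n.2) := fun t =>
    isLinearMap_finsuppSum _ (fun _ _ _ => add_mul _ _ _) (fun _ _ _ => mul_assoc _ _ _)
  refine ⟨fun a b => ?_, fun c a => ?_⟩
  · simp only [rewardFrom]
    rw [← Finset.sum_add_distrib]
    refine Finset.sum_congr rfl fun t _ => ?_
    rw [(isLinearMap_playLaw gA gB τ t).map_add]
    exact (h t).map_add _ _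
  · simp only [rewardFrom]
    rw [Finset.smul_sum]
    refine Finset.sum_congr rfl fun t _ => ?_
    rw [(isLinearMap_playLaw gA gB τ t).map_smul]
    exact (h t).map_smul _ _

/-! ### Restarting the play one stage later. -/

theorem playLaw_of_lt (gA : StratA G) (gB : StratB G) {τ : ℕ}
    (ν : (Traj X τ × HistB G τ) →₀ ℝ) {t : ℕ} (ht : t < τ) : playLaw gA gB τ ν t = 0 := by
  induction t with
  | zero => exact Pi.single_eq_of_ne ht.ne _
  | succ t ih =>
    rw [playLaw, ih (by omega), (isLinearMap_advance gB t).map_zero,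
      (isLinearMap_observe gA (t + 1)).map_zero, Pi.single_eq_of_ne ht.ne, add_zero]

theorem playLaw_self (gA : StratA G) (gB : StratB G) (τ : ℕ)
    (ν : (Traj X τ × HistB G τ) →₀ ℝ) : playLaw gA gB τ ν τ = ν := by
  cases τ with
  | zero => exact Pi.single_eq_same _ _
  | succ t =>
    rw [playLaw, playLaw_of_lt gA gB ν (Nat.lt_succ_self t), (isLinearMap_advance gB t).map_zero,
      (isLinearMap_observe gA (t + 1)).map_zero, Pi.single_eq_same, add_zero]

theorem playLaw_succ (gA : StratA G) (gB : StratB G) {τ : ℕ}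
    (ν : (Traj X τ × HistB G τ) →₀ ℝ) {t : ℕ} (ht : τ ≤ t) :
    playLaw gA gB τ ν (t + 1) = observe gA (advance gB (playLaw gA gB τ ν t)) := by
  rw [playLaw, Pi.single_eq_of_ne (by omega), zero_add]

theorem playLaw_shift (gA : StratA G) (gB : StratB G) {τ : ℕ}
    (ν : (Traj X τ × HistB G τ) →₀ ℝ) {t : ℕ} (ht : τ + 1 ≤ t) :
    playLaw gA gB τ ν t = playLaw gA gB (τ + 1) (observe gA (advance gB ν)) t := by
  induction t, ht using Nat.le_induction with
  | base => rw [playLaw_self, playLaw_succ gA gB ν le_rfl, playLaw_self]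
  | succ t ht ih => rw [playLaw_succ gA gB ν (by omega), playLaw_succ gA gB _ ht, ih]

theorem rewardFrom_of_le (i : Player) (gA : StratA G) (gB : StratB G) {τ : ℕ} (hτ : G.T ≤ τ)
    (ν : (Traj X τ × HistB G τ) →₀ ℝ) : rewardFrom i gA gB τ ν = 0 := by
  rw [rewardFrom, Finset.Ico_eq_empty_of_le hτ, Finset.sum_empty]

theorem rewardFrom_eq_add (i : Player) (gA : StratA G) (gB : StratB G) {τ : ℕ} (hτ : τ < G.T)
    (ν : (Traj X τ × HistB G τ) →₀ ℝ) :
    rewardFrom i gA gB τ ν = (ν.sum fun n p => p * G.reward i τ n.1.last (gB τ n.2)) +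
      rewardFrom i gA gB (τ + 1) (observe gA (advance gB ν)) := by
  rw [rewardFrom, Finset.sum_eq_sum_Ico_succ_bot hτ, playLaw_self, rewardFrom]
  congr 1
  refine Finset.sum_congr rfl fun t ht => ?_
  rw [playLaw_shift gA gB ν (Finset.mem_Ico.1 ht).1]

/-! ### Laws concentrated on a single history. -/

theorem map_sum_of_isLinearMap {ι V W : Type*} [AddCommGroup V] [Module ℝ V] [AddCommGroup W]
    [Module ℝ W] {f : V → W} (hf : IsLinearMap ℝ f) (s : Finset ι) (v : ι → V) :
    f (∑ i ∈ s, v i) = ∑ i ∈ s, f (v i) :=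
  map_sum hf.mk' v s

open Classical in
theorem advance_atHist (gB : StratB G) {t : ℕ} (p : Prob (Traj X t)) (k : HistB G t) :
    advance gB (atHist p k) = if hu : gB t k ∈ G.quit t then 0
      else atHist (nextTraj G p (gB t k)) (k.act (gB t k) hu) := by
  rw [atHist, map_sum_of_isLinearMap (isLinearMap_advance gB t)]
  have h : ∀ x : Traj X t, advance gB (Finsupp.single (x, k) (p x)) =
      if hu : gB t k ∈ G.quit t then 0 else ∑ x' : X (t + 1),
        Finsupp.single ((x, x'), k.act (gB t k) hu) (p x * G.trans t x.last (gB t k) x') := by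
    intro x
    rw [advance, Finsupp.sum_single_index]
    · rfl
    · split_ifs
      · rfl
      · simp only [zero_mul]
        exact Finset.sum_eq_zero fun _ _ => Finsupp.single_zero _
  rw [Finset.sum_congr rfl fun x _ => h x]
  split_ifs with hu
  · exact Finset.sum_eq_zero fun _ _ => rfl
  · exact (Fintype.sum_prod_type (f := fun y : Traj X t × X (t + 1) =>
      Finsupp.single ((y : Traj X (t + 1)), k.act (gB t k) hu)
        (p y.1 * G.trans t y.1.last (gB t k) y.2))).symm

variable [∀ t, Nonempty (X t)]

/-- Disintegration by outcome: each outcome leads to one receiver history, with the posterior as law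
of the trajectory and the outcome's probability as weight. -/
theorem observe_atHist (gA : StratA G) {t : ℕ} (p : Prob (Traj X t)) (h : HistA G t) :
    observe gA (atHist p h) = ∑ m, (∑ y, p y * gA t h y.last m) •
      atHist (posteriorTraj p (gA t h) m) (⟨h, gA t h, m⟩ : HistB G t) := by
  rw [atHist, map_sum_of_isLinearMap (isLinearMap_observe gA t)]
  have h1 : ∀ x : Traj X t, observe gA (Finsupp.single (x, h) (p x)) =
      ∑ m, Finsupp.single (x, (⟨h, gA t h, m⟩ : HistB G t)) (p x * gA t h x.last m) := by
    intro x
    rw [observe, Finsupp.sum_single_index]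
    simp
  simp only [h1, atHist, Finset.smul_sum, Finsupp.smul_single, smul_eq_mul,
    mass_mul_posteriorTraj]
  rw [Finset.sum_comm]

theorem payoffAtA_eq (i : Player) (gA : StratA G) (gB : StratB G) {t : ℕ} (h : HistA G t) :
    payoffAtA i gA gB (canonTrajA h) h = ∑ m, (∑ x, canonA h x * gA t h x m) *
      payoffAtB i gA gB (canonTrajB ⟨h, gA t h, m⟩) ⟨h, gA t h, m⟩ := by
  have hl := isLinearMap_rewardFrom i gA gB t
  rw [payoffAtA, observe_atHist, map_sum_of_isLinearMap hl]
  refine Finset.sum_congr rfl fun m _ => ?_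
  rw [hl.map_smul, smul_eq_mul, hasLast_canonTrajA h fun x => gA t h x m]
  rfl

open Classical in
theorem payoffAtB_eq (i : Player) (gA : StratA G) (gB : StratB G) {t : ℕ} (ht : t < G.T)
    (k : HistB G t) :
    payoffAtB i gA gB (canonTrajB k) k = ∑ x, G.reward i t x (gB t k) * canonB k x +
      if hu : gB t k ∈ G.quit t then 0
      else payoffAtA i gA gB (canonTrajA (k.act (gB t k) hu)) (k.act (gB t k) hu) := by
  rw [payoffAtB, rewardFrom_eq_add i gA gB ht, advance_atHist]
  congr 1
  · have hl : IsLinearMap ℝ fun ν : (Traj X t × HistB G t) →₀ ℝ =>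
        ν.sum fun n p => p * G.reward i t n.1.last (gB t n.2) :=
      isLinearMap_finsuppSum _ (fun _ _ _ => add_mul _ _ _) (fun _ _ _ => mul_assoc _ _ _)
    have h1 := map_sum_of_isLinearMap hl Finset.univ
      fun x : Traj X t => Finsupp.single (x, k) (canonTrajB k x)
    simp only [Finsupp.sum_single_index, zero_mul] at h1
    rw [atHist, h1, hasLast_canonTrajB k fun x => G.reward i t x (gB t k)]
    simp only [mul_comm]
  · split_ifs with hu
    · rw [(isLinearMap_observe gA (t + 1)).map_zero,
        (isLinearMap_rewardFrom i gA gB (t + 1)).map_zero]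
    · rfl

end Payoffs

/-! ### Backward induction -/

section Induction

variable {X U M : ℕ → Type*} [∀ t, Fintype (X t)] [∀ t, Nonempty (X t)] [∀ t, Fintype (U t)]
  [∀ t, Fintype (M t)] {G : SignalGame X U M} {V : Player → ∀ t, Prob (X t) → ℝ}
  {γ : ∀ t, Triangulation (stdSimplex ℝ (X t))}
  {lA : ∀ t, Prob (X t) → Experiment X M t} {lB : ∀ t, Prob (X t) → U t}

omit [∀ t, Nonempty (X t)] [∀ t, Fintype (M t)] in
theorem qHat_le_vHat_receiver (t : ℕ) (π : Prob (X t)) (u : U t) :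
    qHat G V .B t π u ≤ vHat G V .B t π :=
  le_csSup (Set.finite_range _).bddAbove ⟨u, rfl⟩

namespace IsRecursionOutcome

variable (h : IsRecursionOutcome G V γ lA lB)
include h

/-- The action lies in `bestActions` and breaks ties for the principal, so it attains both players'
values. -/
theorem qHat_action {t : ℕ} (ht : t < G.T) (i : Player) (π : Prob (X t)) :
    qHat G V i t π (lB t π) = vHat G V i t π := by
  cases i with
  | A => exact (h.action t ht π).2
  | B =>
    refine le_antisymm (qHat_le_vHat_receiver t π _) (csSup_le ⟨_, lB t π, rfl⟩ ?_)
    rintro _ ⟨u, rfl⟩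
    exact (h.action t ht π).1 u

omit [∀ t, Fintype (U t)] in
theorem value_eq {t : ℕ} (ht : t < G.T) (i : Player) (π : Prob (X t)) :
    V i t π = ∑ m, (∑ x, π x * lA t π x m) * vHat G V i t (bayesUpdate π (lA t π) m) := by
  rw [h.value t ht i, interpolate_eq_of_induces (h.experiment t ht π)]

/-- Inductive step for an upper bound uniform in the belief, needed because the concave closure is a
real supremum. -/
theorem exists_vHat_le_of_value_le {t : ℕ} (ht : t < G.T) (i : Player) {C : ℝ} (hC : 0 ≤ C)
    (hV : ∀ π, V i (t + 1) π ≤ C) : ∃ D, 0 ≤ D ∧ ∀ π, vHat G V i t π ≤ D := by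
  -- The double sum dominates the stage reward for every action; `0 ≤ C` covers termination.
  refine ⟨∑ x, ∑ u, |G.reward i t x u| + C, by positivity, fun π => ?_⟩
  rw [← h.qHat_action ht, qHat]
  refine add_le_add (Finset.sum_le_sum fun x _ => ?_) ?_
  · have hπ : π x ≤ 1 := by
      rw [← π.sum_eq_one]
      exact Finset.single_le_sum (fun y _ => π.nonneg y) (Finset.mem_univ x)
    calc G.reward i t x (lB t π) * π x ≤ |G.reward i t x (lB t π)| * π x :=
          mul_le_mul_of_nonneg_right (le_abs_self _) (π.nonneg x)
      _ ≤ |G.reward i t x (lB t π)| := mul_le_of_le_one_right (abs_nonneg _) hπ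
      _ ≤ _ := Finset.single_le_sum (f := fun u => |G.reward i t x u|)
          (fun u _ => abs_nonneg _) (Finset.mem_univ _)
  · split_ifs
    · exact hC
    · exact hV _

theorem exists_value_le (i : Player) {t : ℕ} (ht : t ≤ G.T) :
    ∃ C, 0 ≤ C ∧ ∀ π, V i t π ≤ C := by
  induction ht using Nat.decreasingInduction with
  | self => exact ⟨0, le_rfl, fun π => (h.terminal i π).le⟩
  | of_succ t ht ih =>
    obtain ⟨C, hC, hV⟩ := ih
    obtain ⟨D, hD, hv⟩ := h.exists_vHat_le_of_value_le ht i hC hV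
    refine ⟨D, hD, fun π => ?_⟩
    rw [h.value_eq ht]
    calc _ ≤ ∑ m, (∑ x, π x * lA t π x m) * D := Finset.sum_le_sum fun m _ =>
          mul_le_mul_of_nonneg_left (hv _) (mass_nonneg _ _ _)
      _ = D := by rw [← Finset.sum_mul, sum_mass, one_mul]

theorem sum_mass_mul_vHat_le {t : ℕ} (ht : t < G.T) (π : Prob (X t)) (σ : Experiment X M t) :
    ∑ m, (∑ x, π x * σ x m) * vHat G V .A t (bayesUpdate π σ m) ≤ V .A t π := by
  obtain ⟨C, hC, hV⟩ := h.exists_value_le .A ht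
  obtain ⟨D, -, hv⟩ := h.exists_vHat_le_of_value_le ht .A hC hV
  have hcav : interpolate (vHat G V .A t) (γ t) = concaveClosure (vHat G V .A t) :=
    h.triangulation t ht
  rw [h.value t ht .A, hcav]
  exact sum_mass_mul_le_concaveClosure hv π σ

/-! ### Payoffs under the given strategies. -/

theorem payoffAtB_eq_vHat {t : ℕ} (ht : t < G.T) (i : Player)
    (hnext : ∀ h' : HistA G (t + 1),
      payoffAtA i (cbbA G lA) (cbbB G lB) (canonTrajA h') h' = V i (t + 1) (canonA h'))
    (k : HistB G t) :
    payoffAtB i (cbbA G lA) (cbbB G lB) (canonTrajB k) k = vHat G V i t (canonB k) := by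
  rw [payoffAtB_eq i _ _ ht, ← h.qHat_action ht, qHat]
  simp only [hnext, canonA_act, dite_eq_ite]
  rfl

theorem payoffAtA_eq_value (i : Player) {t : ℕ} (ht : t ≤ G.T) (h' : HistA G t) :
    payoffAtA i (cbbA G lA) (cbbB G lB) (canonTrajA h') h' = V i t (canonA h') := by
  induction ht using Nat.decreasingInduction with
  -- Stages run from `0` to `G.T - 1`, so nothing is left to earn at `G.T`.
  | self => rw [h.terminal, payoffAtA, rewardFrom_of_le i _ _ le_rfl]
  | of_succ t ht ih =>
    rw [payoffAtA_eq, h.value_eq ht]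
    simp only [h.payoffAtB_eq_vHat ht i ih]
    rfl

/-! ### Bounds on payoffs after deviations. -/

theorem payoffAtB_principal_le {t : ℕ} (ht : t < G.T) (gA : StratA G)
    (hnext : ∀ h' : HistA G (t + 1),
      payoffAtA .A gA (cbbB G lB) (canonTrajA h') h' ≤ V .A (t + 1) (canonA h'))
    (k : HistB G t) :
    payoffAtB .A gA (cbbB G lB) (canonTrajB k) k ≤ vHat G V .A t (canonB k) := by
  rw [payoffAtB_eq .A _ _ ht, ← h.qHat_action ht, qHat]
  refine add_le_add le_rfl ?_
  by_cases hu : cbbB G lB t k ∈ G.quit t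
  · rw [dif_pos hu, if_pos (c := lB t (canonB k) ∈ G.quit t) hu]
  · rw [dif_neg hu, if_neg (c := lB t (canonB k) ∈ G.quit t) hu]
    exact hnext _

theorem payoffAtA_principal_le (gA : StratA G) {t : ℕ} (ht : t ≤ G.T) (h' : HistA G t) :
    payoffAtA .A gA (cbbB G lB) (canonTrajA h') h' ≤ V .A t (canonA h') := by
  induction ht using Nat.decreasingInduction with
  | self => rw [h.terminal, payoffAtA, rewardFrom_of_le .A _ _ le_rfl]
  | of_succ t ht ih =>
    rw [payoffAtA_eq]
    refine le_trans (Finset.sum_le_sum fun m _ => ?_) (h.sum_mass_mul_vHat_le ht _ (gA t h'))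
    exact mul_le_mul_of_nonneg_left (h.payoffAtB_principal_le ht gA ih _) (mass_nonneg _ _ _)

omit h in
theorem payoffAtB_receiver_le {t : ℕ} (ht : t < G.T) (gB : StratB G)
    (hnext : ∀ h' : HistA G (t + 1),
      payoffAtA .B (cbbA G lA) gB (canonTrajA h') h' ≤ V .B (t + 1) (canonA h'))
    (k : HistB G t) :
    payoffAtB .B (cbbA G lA) gB (canonTrajB k) k ≤ vHat G V .B t (canonB k) := by
  refine le_trans ?_ (qHat_le_vHat_receiver t (canonB k) (gB t k))
  rw [payoffAtB_eq .B _ _ ht, qHat]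
  refine add_le_add le_rfl ?_
  split_ifs with hu
  · exact le_rfl
  · exact hnext _

/-- The experiment is still `lA`, so `value_eq` applies as an equality and concavity plays no role.
-/
theorem payoffAtA_receiver_le (gB : StratB G) {t : ℕ} (ht : t ≤ G.T) (h' : HistA G t) :
    payoffAtA .B (cbbA G lA) gB (canonTrajA h') h' ≤ V .B t (canonA h') := by
  induction ht using Nat.decreasingInduction with
  | self => rw [h.terminal, payoffAtA, rewardFrom_of_le .B _ _ le_rfl]
  | of_succ t ht ih =>
    rw [payoffAtA_eq, h.value_eq ht]
    refine Finset.sum_le_sum fun m _ => ?_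
    exact mul_le_mul_of_nonneg_left (payoffAtB_receiver_le ht gB ih _) (mass_nonneg _ _ _)

theorem sequentiallyRational :
    SequentiallyRational (cbbA G lA) (cbbB G lB) (canonBeliefs G) where
  principal _ ht h' gA :=
    (h.payoffAtA_principal_le gA ht.le h').trans_eq (h.payoffAtA_eq_value .A ht.le h').symm
  receiver _ ht k gB :=
    (payoffAtB_receiver_le ht gB (h.payoffAtA_receiver_le gB ht) k).trans_eq
      (h.payoffAtB_eq_vHat ht .B (h.payoffAtA_eq_value .B ht) k).symm

end IsRecursionOutcome

end Induction

end SignalPicking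

end

theorem proposition2 {X U M : ℕ → Type*}
    [∀ t, Fintype (X t)] [∀ t, Nonempty (X t)]
    [∀ t, Fintype (U t)] [∀ t, Fintype (M t)]
    (G : SignalPicking.SignalGame X U M)
    (V : SignalPicking.Player → ∀ t, SignalPicking.Prob (X t) → ℝ)
    (γ : ∀ t, SignalPicking.Triangulation (stdSimplex ℝ (X t)))
    (lA : ∀ t, SignalPicking.Prob (X t) → SignalPicking.Experiment X M t)
    (lB : ∀ t, SignalPicking.Prob (X t) → U t)
    (h : SignalPicking.IsRecursionOutcome G V γ lA lB) :
    (∃ μ : SignalPicking.BeliefSystem G,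
      SignalPicking.IsPBE (SignalPicking.cbbA G lA) (SignalPicking.cbbB G lB) μ) ∧
    ∀ i : SignalPicking.Player,
      SignalPicking.payoff i (SignalPicking.cbbA G lA) (SignalPicking.cbbB G lB) =
        V i 0 G.prior :=
  ⟨⟨_, h.sequentiallyRational, SignalPicking.bayesConsistent_canonBeliefs⟩,
    -- At the empty history both `canonTrajA` and `canonA` reduce to the prior.
    fun i => h.payoffAtA_eq_value i (Nat.zero_le _) SignalPicking.HistA.nil⟩
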